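/- All rings are commutative with $1$. For a ring $R$, an étale $R$-algebra of degree $n$ is an étale $R$-algebra $A$ that is a finitely generated projective $R$-module of constant rank $n$ (quadratic means $n=2$). We say that $A$ is generated by $m$ elements if there are $a_1,\dots,a_m\in A$ such that no proper $R$-subalgebra of $A$ contains all of them. **Proposition (Ojanguren).** Let $r\ge 1$, let $S=\mathbb{R}[z_1,\dots,z_r]/\bigl(\sum_{i=1}^r z_i^2-1\bigr)$, let the group $C_2$ of order two act on the $\mathbb{R}$-algebra $S$ by $z_i\mapsto -z_i$, and let $R=S^{C_2}$ be the fixed ring. 1. $R$ is a smooth $\mathbb{R}$-algebra of Krull dimension $r-1$. 2. $S$ is a quadratic étale $R$-algebra. It can be generated by $r$ elements over $R$, but not by fewer than $r$ elements. 3. For every $n\ge 2$, the $R$-algebra $S\times R^{n-2}$ is étale of degree $n$. It can be generated by $r=\dim R+1$ elements over $R$, but not by fewer than $r$ elements. Consequently the bound $\dim R+1$ of First and Reichstein on the number of generators of an étale algebra cannot be improved in any dimension $d\ge 0$ and any degree $n\ge 2$: if $m$ is a number such that, for every smooth $\mathbb{R}$-algebra $R'$ of Krull dimension $d$, every étale $R'$-algebra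 of degree $n$ can be generated by $m$ elements, then $m\ge d+1$. -/

import Mathlib

/-!
Since `∑ zᵢ ^ 2 = 1`, the antipodal involution acts freely on the sphere, so `S` is a Galois
extension of `R` with group `C₂`: the elements `z₁, …, zᵣ` exhibit the splitting
`S ⊗[R] S ≃ S × S`, and étaleness and the rank descend to `S` over `R`. Where `zᵢ ^ 2` is
invertible, `S` maps to the quadratic algebra `R[zᵢ⁻²][ω]`, `ω ^ 2 = zᵢ ^ 2`, which lets
infinitesimal liftings descend from `S` to `R`; this gives smoothness. Both rings have dimension
`r - 1`, as `S` is integral over `R` and over the polynomial ring in all but one of the `zᵢ`.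
Finally `S × R ^ k` has `r` generators because the sphere and finitely many rational points off it
are disjoint closed subschemes of affine `r`-space.

For the lower bound, write `a⁻` for the difference of `a` and its image under the involution. If
`m < r` elements `a₁, …, aₘ` generated `S`, then by the Borsuk–Ulam theorem the odd functions
`a₁⁻, …, aₘ⁻` would have a common zero `u` on the real sphere, and no element of `S` would separate
`u` from `-u`, although the coordinates do.

The polynomial Borsuk–Ulam theorem is proved algebraically. For forms `fᵢ` of odd degrees `dᵢ`, the
equations `Xᵢ ^ dᵢ + s fᵢ = 0` define, for all but countably many `s`, an algebra of odd dimension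
`∏ dᵢ`, which therefore has a real point. A limit of these points as `s → ∞`, which exists by
compactness of the sphere, is a common zero of the `fᵢ`.
-/

open MvPolynomial

noncomputable section

/-- The cyclic group of order two, written multiplicatively. -/
abbrev C₂ : Type := Multiplicative (ZMod 2)

/-- The ideal of `ℝ[z₁, …, z_r]` generated by `∑ zᵢ² - 1`. -/
def sphereIdeal (r : ℕ) : Ideal (MvPolynomial (Fin r) ℝ) :=
  Ideal.span {∑ i, X i ^ 2 - 1}

/-- The ring `S = ℝ[z₁, …, z_r] / (∑ zᵢ² - 1)`. -/
def SphereRing (r : ℕ) : Type := MvPolynomial (Fin r) ℝ ⧸ sphereIdeal r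

instance SphereRing.instCommRing (r : ℕ) : CommRing (SphereRing r) :=
  inferInstanceAs (CommRing (MvPolynomial (Fin r) ℝ ⧸ sphereIdeal r))

instance SphereRing.instAlgebra (r : ℕ) : Algebra ℝ (SphereRing r) :=
  inferInstanceAs (Algebra ℝ (MvPolynomial (Fin r) ℝ ⧸ sphereIdeal r))

/-- The quotient map from `ℝ[z₁, …, z_r]` to `S`. -/
def SphereRing.mk (r : ℕ) : MvPolynomial (Fin r) ℝ →ₐ[ℝ] SphereRing r :=
  Ideal.Quotient.mkₐ ℝ (sphereIdeal r)

theorem SphereRing.mk_surjective (r : ℕ) : Function.Surjective (SphereRing.mk r) :=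
  Ideal.Quotient.mkₐ_surjective ℝ (sphereIdeal r)

theorem SphereRing.mk_eq_zero_iff {r : ℕ} (p : MvPolynomial (Fin r) ℝ) :
    SphereRing.mk r p = 0 ↔ p ∈ sphereIdeal r :=
  Ideal.Quotient.eq_zero_iff_mem

/-- The class of the variable `zᵢ` in `S`. -/
def SphereRing.z {r : ℕ} (i : Fin r) : SphereRing r := SphereRing.mk r (X i)

theorem SphereRing.sum_z_sq (r : ℕ) : ∑ i : Fin r, SphereRing.z i ^ 2 = 1 := by
  have h : SphereRing.mk r (∑ i, X i ^ 2 - 1) = 0 :=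
    (SphereRing.mk_eq_zero_iff _).2 (Ideal.subset_span rfl)
  simpa [SphereRing.z, sub_eq_zero] using h

/-- The endomorphism of the `ℝ`-algebra `S` with `zᵢ ↦ -zᵢ`. -/
def SphereRing.negHom (r : ℕ) : SphereRing r →ₐ[ℝ] SphereRing r :=
  Ideal.Quotient.liftₐ (sphereIdeal r)
    (aeval fun i => -SphereRing.z i : MvPolynomial (Fin r) ℝ →ₐ[ℝ] SphereRing r) (by
    intro a ha
    have h : sphereIdeal r ≤
        RingHom.ker (aeval fun i => -SphereRing.z i : MvPolynomial (Fin r) ℝ →ₐ[ℝ] SphereRing r) := by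
      refine (Ideal.span_singleton_le_iff_mem _).2 (RingHom.mem_ker.2 ?_)
      simp [SphereRing.sum_z_sq]
    exact h ha)

theorem SphereRing.negHom_z {r : ℕ} (i : Fin r) :
    SphereRing.negHom r (SphereRing.z i) = -SphereRing.z i := by
  have h : SphereRing.negHom r (SphereRing.z i) =
      (aeval fun i => -SphereRing.z i : MvPolynomial (Fin r) ℝ →ₐ[ℝ] SphereRing r) (X i) := rfl
  rw [h, aeval_X]

theorem SphereRing.negHom_comp_negHom (r : ℕ) :
    (SphereRing.negHom r).comp (SphereRing.negHom r) = AlgHom.id ℝ (SphereRing r) := by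
  have h : ((SphereRing.negHom r).comp (SphereRing.negHom r)).comp (SphereRing.mk r) =
      (AlgHom.id ℝ (SphereRing r)).comp (SphereRing.mk r) := by
    apply MvPolynomial.algHom_ext
    intro i
    change SphereRing.negHom r (SphereRing.negHom r (SphereRing.z i)) = SphereRing.z i
    rw [SphereRing.negHom_z, map_neg, SphereRing.negHom_z, neg_neg]
  ext x
  obtain ⟨p, rfl⟩ := SphereRing.mk_surjective r x
  exact DFunLike.congr_fun h p

/-- The automorphism of the `ℝ`-algebra `S` with `zᵢ ↦ -zᵢ`. -/
def SphereRing.neg (r : ℕ) : SphereRing r ≃ₐ[ℝ] SphereRing r :=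
  AlgEquiv.ofAlgHom (SphereRing.negHom r) (SphereRing.negHom r)
    (SphereRing.negHom_comp_negHom r) (SphereRing.negHom_comp_negHom r)

theorem SphereRing.neg_mul_neg (r : ℕ) : SphereRing.neg r * SphereRing.neg r = 1 :=
  AlgEquiv.ext fun x => DFunLike.congr_fun (SphereRing.negHom_comp_negHom r) x

/-- The homomorphism from the group of order two to the automorphisms of `S` that sends the
generator to `zᵢ ↦ -zᵢ`. -/
def SphereRing.actionHom (r : ℕ) : C₂ →* (SphereRing r ≃ₐ[ℝ] SphereRing r) :=
  AddMonoidHom.toMultiplicativeLeft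
    (ZMod.lift 2 ⟨zmultiplesHom _ (Additive.ofMul (SphereRing.neg r)), by
      change (2 : ℤ) • Additive.ofMul (SphereRing.neg r) = 0
      rw [two_zsmul]
      exact congrArg Additive.ofMul (SphereRing.neg_mul_neg r)⟩)

/-- The action of the group of order two on `S` by `zᵢ ↦ -zᵢ`. -/
instance SphereRing.action (r : ℕ) : MulSemiringAction C₂ (SphereRing r) :=
  MulSemiringAction.compHom (SphereRing r) (SphereRing.actionHom r)

theorem SphereRing.generator_smul (r : ℕ) (x : SphereRing r) :
    (Multiplicative.ofAdd (1 : ZMod 2) : C₂) • x = SphereRing.neg r x := by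
  change SphereRing.actionHom r (Multiplicative.ofAdd (1 : ZMod 2)) x = _
  have h : SphereRing.actionHom r (Multiplicative.ofAdd (1 : ZMod 2)) = SphereRing.neg r := by
    have := ZMod.lift_coe 2 (⟨zmultiplesHom _ (Additive.ofMul (SphereRing.neg r)), by
      change (2 : ℤ) • Additive.ofMul (SphereRing.neg r) = 0
      rw [two_zsmul]
      exact congrArg Additive.ofMul (SphereRing.neg_mul_neg r)⟩ :
        { f : ℤ →+ Additive (SphereRing r ≃ₐ[ℝ] SphereRing r) // f (2 : ℕ) = 0 }) 1
    simp only [Int.cast_one, zmultiplesHom_apply, one_zsmul] at this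
    exact congrArg Additive.toMul this
  rw [h]

theorem SphereRing.generator_smul_z {r : ℕ} (i : Fin r) :
    (Multiplicative.ofAdd (1 : ZMod 2) : C₂) • SphereRing.z i = -SphereRing.z i := by
  rw [SphereRing.generator_smul]
  exact SphereRing.negHom_z i

instance SphereRing.smulCommClass (r : ℕ) : SMulCommClass C₂ ℝ (SphereRing r) where
  smul_comm g a x := map_smul (SphereRing.actionHom r g) a x

/-- The fixed ring `R = S^{C₂}`, an `ℝ`-subalgebra of `S`. -/
abbrev SphereRing.Fixed (r : ℕ) : Subalgebra ℝ (SphereRing r) :=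
  FixedPoints.subalgebra ℝ (SphereRing r) C₂

end

/-- `A` is an étale `R`-algebra of degree `n`: it is étale, and it is a finitely generated
projective `R`-module of constant rank `n`. -/
structure IsEtaleOfDegree (R A : Type*) [CommRing R] [CommRing A] [Algebra R A] (n : ℕ) :
    Prop where
  etale : Algebra.Etale R A
  finite : Module.Finite R A
  projective : Module.Projective R A
  rank_eq : ∀ p : PrimeSpectrum R, Module.rankAtStalk (R := R) A p = n

/-- The `R`-algebra `A` can be generated by `m` elements. -/
def IsGeneratedBy (R A : Type*) [CommRing R] [CommRing A] [Algebra R A] (m : ℕ) : Prop :=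
  ∃ a : Fin m → A, Algebra.adjoin R (Set.range a) = ⊤

/-! ### Galois extensions of commutative rings -/

section Galois

open scoped TensorProduct

variable {R S G ι : Type*} [CommRing R] [CommRing S] [Algebra R S] [Group G]
  [MulSemiringAction G S] [Fintype ι]

/-- The families `x` and `y` exhibit the action of `G` on `S` as free, in the sense of
Chase, Harrison and Rosenberg: `S` is a Galois extension of its ring of invariants. -/
def IsGaloisSystem (G : Type*) [Group G] [MulSemiringAction G S] [DecidableEq G]
    (x y : ι → S) : Prop :=
  ∀ g : G, ∑ i, x i * g • y i = if g = 1 then 1 else 0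

section Trace

variable (R S G) [Fintype G] [SMulCommClass G R S] [Algebra.IsInvariant R S G] [FaithfulSMul R S]

/-- The trace `s ↦ ∑ g, g • s` of a finite group `G` acting on `S`, with values in the ring `R`
of invariants. -/
noncomputable def invariantTrace : S →ₗ[R] R :=
  (LinearEquiv.ofInjective (Algebra.linearMap R S) (FaithfulSMul.algebraMap_injective R S)).symm ∘ₗ
    (∑ g : G, (DistribSMul.toLinearMap R S g)).codRestrict (LinearMap.range (Algebra.linearMap R S))
      fun s ↦ Algebra.IsInvariant.isInvariant (G := G) _ fun g ↦ by
        simp only [LinearMap.sum_apply, DistribSMul.toLinearMap_apply, Finset.smul_sum, smul_smul]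
        exact Fintype.sum_equiv (Equiv.mulLeft g) _ _ fun _ ↦ rfl

theorem algebraMap_invariantTrace (s : S) :
    algebraMap R S (invariantTrace R S G s) = ∑ g : G, g • s := by
  refine (congrArg Subtype.val (LinearEquiv.apply_symm_apply (LinearEquiv.ofInjective
    (Algebra.linearMap R S) (FaithfulSMul.algebraMap_injective R S)) _)).trans ?_
  exact LinearMap.sum_apply _ _ _

end Trace

variable [DecidableEq G] {x y : ι → S}

namespace IsGaloisSystem

theorem sum_smul_mul_smul (h : IsGaloisSystem G x y) (g g' : G) :
    ∑ i, g • x i * g' • y i = if g = g' then 1 else 0 := by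
  have := congrArg (g • ·) (h (g⁻¹ * g'))
  simpa only [Finset.smul_sum, smul_mul', smul_smul, mul_inv_cancel_left, smul_ite, smul_one,
    smul_zero, inv_mul_eq_one] using this

variable [SMulCommClass G R S] [Algebra.IsInvariant R S G] [FaithfulSMul R S]

variable (R) in
theorem sum_invariantTrace_smul [Fintype G] (h : IsGaloisSystem G x y) (s : S) :
    ∑ i, invariantTrace R S G (s * x i) • y i = s := by
  have hg (g : G) : ∑ i, g • x i * y i = if g = 1 then 1 else 0 := by
    simpa only [one_smul] using h.sum_smul_mul_smul g 1
  simp only [Algebra.smul_def, algebraMap_invariantTrace, Finset.sum_mul, smul_mul', mul_assoc]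
  rw [Finset.sum_comm]
  simp only [← Finset.mul_sum, hg, mul_ite, mul_one, mul_zero, Finset.sum_ite_eq', Finset.mem_univ,
    if_true, one_smul]

variable (R) in
theorem finite [Finite G] (h : IsGaloisSystem G x y) : Module.Finite R S :=
  let _ := Fintype.ofFinite G
  .of_surjective (Fintype.linearCombination R y) fun s ↦ ⟨_, h.sum_invariantTrace_smul R s⟩

variable (R) in
theorem projective [Finite G] (h : IsGaloisSystem G x y) : Module.Projective R S :=
  let _ := Fintype.ofFinite G
  .of_split (LinearMap.pi fun i ↦ invariantTrace R S G ∘ₗ LinearMap.mulRight R (x i))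
    (Fintype.linearCombination R y) (LinearMap.ext (h.sum_invariantTrace_smul R))

variable (R S G) in
/-- The homomorphism `s ⊗ t ↦ (s * g • t)_g`, which splits a Galois extension by base change to
itself. -/
noncomputable def tensorToPi : S ⊗[R] S →ₐ[S] G → S :=
  Algebra.TensorProduct.lift (Algebra.ofId S (G → S))
    (AlgHom.pi fun g ↦ MulSemiringAction.toAlgHom R S g) fun _ _ ↦ Commute.all _ _

theorem tensorToPi_bijective [Finite G] (h : IsGaloisSystem G x y) :
    Function.Bijective (tensorToPi R S G) := by
  let _ := Fintype.ofFinite G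
  have tmul_apply (s t : S) (g : G) : tensorToPi R S G (s ⊗ₜ t) g = s * g • t := rfl
  let inv : (G → S) →ₗ[S] S ⊗[R] S :=
    Fintype.linearCombination S fun g ↦ ∑ i, (g • x i) ⊗ₜ[R] y i
  have left_inv : inv ∘ₗ (tensorToPi R S G).toLinearMap = LinearMap.id := by
    refine TensorProduct.AlgebraTensorModule.curry_injective (LinearMap.ext_ring ?_)
    ext t
    calc ∑ g : G, (1 * g • t) • ∑ i, (g • x i) ⊗ₜ[R] y i
        = ∑ i, ∑ g : G, (g • (t * x i)) ⊗ₜ[R] y i := by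
          simp only [one_mul, Finset.smul_sum, TensorProduct.smul_tmul', smul_eq_mul, smul_mul']
          exact Finset.sum_comm
      _ = 1 ⊗ₜ[R] ∑ i, invariantTrace R S G (t * x i) • y i := by
          simp only [← TensorProduct.sum_tmul, ← algebraMap_invariantTrace (R := R),
            Algebra.algebraMap_eq_smul_one, TensorProduct.smul_tmul, TensorProduct.tmul_sum]
      _ = 1 ⊗ₜ[R] t := by rw [h.sum_invariantTrace_smul R]
  have right_inv (f : G → S) : tensorToPi R S G (inv f) = f := by
    funext g
    simp only [inv, Fintype.linearCombination_apply, map_sum, map_smul, Finset.sum_apply,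
      Pi.smul_apply, tmul_apply, h.sum_smul_mul_smul, smul_eq_mul, mul_ite, mul_one, mul_zero,
      Finset.sum_ite_eq', Finset.mem_univ, if_true]
  exact ⟨Function.LeftInverse.injective (g := inv) fun t ↦ LinearMap.congr_fun left_inv t,
    Function.RightInverse.surjective right_inv⟩

theorem isEtaleOfDegree [Fintype G] (h : IsGaloisSystem G x y) :
    IsEtaleOfDegree R S (Fintype.card G) := by
  have := h.finite R
  have := h.projective R
  have : Module.FaithfullyFlat R S :=
    .of_comap_surjective (Algebra.IsIntegral.comap_surjective R S)
  let e : S ⊗[R] S ≃ₐ[S] (G → S) := AlgEquiv.ofBijective _ h.tensorToPi_bijective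
  have : Algebra.Etale S (S ⊗[R] S) := .of_equiv e.symm
  refine ⟨.of_etale_tensorProduct_of_faithfullyFlat S, inferInstance, inferInstance, fun p ↦ ?_⟩
  obtain ⟨q, rfl⟩ := Algebra.IsIntegral.comap_surjective R S p
  have : Nontrivial S := q.nontrivial
  rw [← Module.rankAtStalk_baseChange, Module.rankAtStalk_eq_of_equiv e.toLinearEquiv,
    Module.rankAtStalk_eq_finrank_of_free]
  simp

end IsGaloisSystem

end Galois

/-! ### Products of étale algebras -/

section Product

universe u

theorem etale_prod {R : Type*} {A B : Type u} [CommRing R] [CommRing A] [CommRing B]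
    [Algebra R A] [Algebra R B] [Algebra.Etale R A] [Algebra.Etale R B] :
    Algebra.Etale R (A × B) := by
  let F : Bool → Type u := fun b ↦ cond b B A
  let _ (b : Bool) : CommRing (F b) := by cases b <;> assumption
  let _ (b : Bool) : Algebra R (F b) := by cases b <;> assumption
  have (b : Bool) : Algebra.Etale R (F b) := by cases b <;> assumption
  let f : (∀ b, F b) →ₐ[R] A × B := (Pi.evalAlgHom R F false).prod (Pi.evalAlgHom R F true)
  exact .of_equiv (AlgEquiv.ofBijective f
    ⟨fun _ _ h ↦ funext (Bool.rec (congrArg Prod.fst h) (congrArg Prod.snd h)),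
      fun x ↦ ⟨Bool.rec x.1 x.2, rfl⟩⟩)

theorem IsEtaleOfDegree.prod {R : Type*} {A B : Type u} [CommRing R] [CommRing A] [CommRing B]
    [Algebra R A] [Algebra R B] {m n : ℕ} (hA : IsEtaleOfDegree R A m)
    (hB : IsEtaleOfDegree R B n) : IsEtaleOfDegree R (A × B) (m + n) := by
  have := hA.etale
  have := hB.etale
  have := hA.finite
  have := hB.finite
  have := hA.projective
  have := hB.projective
  refine ⟨etale_prod, inferInstance, inferInstance, fun p ↦ ?_⟩
  rw [Module.rankAtStalk_prod, Pi.add_apply, hA.rank_eq, hB.rank_eq]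

theorem isEtaleOfDegree_pi (R ι : Type*) [CommRing R] [Fintype ι] :
    IsEtaleOfDegree R (ι → R) (Fintype.card ι) := by
  refine ⟨inferInstance, inferInstance, inferInstance, fun p ↦ ?_⟩
  have := p.nontrivial
  rw [Module.rankAtStalk_eq_finrank_of_free, Module.finrank_fintype_fun_eq_card]
  rfl

end Product

/-! ### Smoothness -/

section Smooth

variable {k : Type*} [CommRing k]

/-- The homomorphism of quadratic algebras induced by a homomorphism of base rings that matches
the parameters. -/
def quadraticAlgebraMap {A B : Type*} [CommRing A] [CommRing B] [Algebra k A] [Algebra k B]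
    (f : A →ₐ[k] B) {a b : A} {a' b' : B} (ha : f a = a') (hb : f b = b') :
    QuadraticAlgebra A a b →ₐ[k] QuadraticAlgebra B a' b' where
  toFun x := ⟨f x.re, f x.im⟩
  map_one' := QuadraticAlgebra.ext (map_one f) (map_zero f)
  map_mul' x y := by ext <;> simp [← ha, ← hb]
  map_zero' := QuadraticAlgebra.ext (map_zero f) (map_zero f)
  map_add' x y := QuadraticAlgebra.ext (map_add f _ _) (map_add f _ _)
  commutes' c := QuadraticAlgebra.ext (f.commutes c) (map_zero f)

section SquareZero

variable {B : Type*} [CommRing B] [Algebra k B] {I : Ideal B} {a b : B}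

theorem mul_eq_zero_of_sq_eq_bot (hI : I ^ 2 = ⊥) {s t : B} (hs : s ∈ I) (ht : t ∈ I) :
    s * t = 0 := by
  rw [← Ideal.mem_bot, ← hI, sq]
  exact Ideal.mul_mem_mul hs ht

theorem isNilpotent_ker_quadraticAlgebraMap (hI : I ^ 2 = ⊥) {a' b' : B ⧸ I}
    (ha : Ideal.Quotient.mkₐ k I a = a') (hb : Ideal.Quotient.mkₐ k I b = b') :
    IsNilpotent (RingHom.ker (quadraticAlgebraMap (Ideal.Quotient.mkₐ k I) ha hb)) := by
  have mem_of_mem_ker {x : QuadraticAlgebra B a b}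
      (hx : x ∈ RingHom.ker (quadraticAlgebraMap (Ideal.Quotient.mkₐ k I) ha hb)) :
      x.re ∈ I ∧ x.im ∈ I :=
    ⟨Ideal.Quotient.eq_zero_iff_mem.1 (congrArg QuadraticAlgebra.re hx),
      Ideal.Quotient.eq_zero_iff_mem.1 (congrArg QuadraticAlgebra.im hx)⟩
  refine ⟨2, ?_⟩
  rw [sq, Ideal.zero_eq_bot, eq_bot_iff, Ideal.mul_le]
  intro x hx y hy
  obtain ⟨hx₁, hx₂⟩ := mem_of_mem_ker hx
  obtain ⟨hy₁, hy₂⟩ := mem_of_mem_ker hy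
  ext <;> simp [mul_assoc, mul_eq_zero_of_sq_eq_bot hI, hx₁, hx₂, hy₁, hy₂]

theorem exists_algHom_eq_re {R : Type*} [CommRing R] [Algebra k R] (hI : I ^ 2 = ⊥)
    (ψ : R →ₐ[k] QuadraticAlgebra B a b) (hψ : ∀ r, (ψ r).im ∈ I) :
    ∃ f : R →ₐ[k] B, ∀ r, f r = (ψ r).re := by
  let re : QuadraticAlgebra B a b →ₗ[k] B := (QuadraticAlgebra.reₗ a b).restrictScalars k
  refine ⟨.ofLinearMap (re ∘ₗ ψ.toLinearMap) (congrArg QuadraticAlgebra.re (map_one ψ))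
    fun r s ↦ ?_, fun _ ↦ rfl⟩
  change (ψ (r * s)).re = (ψ r).re * (ψ s).re
  rw [map_mul, QuadraticAlgebra.re_mul, mul_assoc, mul_eq_zero_of_sq_eq_bot hI (hψ r) (hψ s),
    mul_zero, add_zero]

end SquareZero

/- A homomorphism `R' → B ⧸ I` with `I ^ 2 = 0` extends through `j` to `S → (B ⧸ I)[ω]`, which lifts
to `S → B[ω]`. On `R` this lift has its `ω`-coordinate in `I`, so that its other coordinate is
multiplicative there. -/
theorem formallySmooth_of_algHom_quadraticAlgebra {R S R' : Type*} [CommRing R] [CommRing S]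
    [CommRing R'] [Algebra k R] [Algebra k S] [Algebra k R'] [Algebra R S] [Algebra R R']
    [IsScalarTower k R S] [IsScalarTower k R R'] [Algebra.FormallySmooth k S]
    [Algebra.FormallyEtale R R'] {a b : R'} (j : S →ₐ[R] QuadraticAlgebra R' a b) :
    Algebra.FormallySmooth k R' := by
  refine .of_comp_surjective fun B _ _ I hI g ↦ ?_
  obtain ⟨a', ha⟩ := Ideal.Quotient.mkₐ_surjective k I (g a)
  obtain ⟨b', hb⟩ := Ideal.Quotient.mkₐ_surjective k I (g b)
  let π := quadraticAlgebraMap (Ideal.Quotient.mkₐ k I) ha hb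
  have π_surjective : Function.Surjective π := fun y ↦ by
    obtain ⟨s, hs⟩ := Ideal.Quotient.mkₐ_surjective k I y.re
    obtain ⟨t, ht⟩ := Ideal.Quotient.mkₐ_surjective k I y.im
    exact ⟨⟨s, t⟩, QuadraticAlgebra.ext hs ht⟩
  let ψ : S →ₐ[k] QuadraticAlgebra B a' b' := Algebra.FormallySmooth.liftOfSurjective
    ((quadraticAlgebraMap g rfl rfl).comp (j.restrictScalars k)) π π_surjective
    (isNilpotent_ker_quadraticAlgebraMap hI ha hb)
  have π_ψ (r : R) : π (ψ (algebraMap R S r)) = ⟨g (algebraMap R R' r), 0⟩ := by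
    refine (Algebra.FormallySmooth.liftOfSurjective_apply ..).trans ?_
    change quadraticAlgebraMap g rfl rfl (j (algebraMap R S r)) = _
    rw [j.commutes]
    exact QuadraticAlgebra.ext rfl (map_zero g)
  obtain ⟨f, hf⟩ := exists_algHom_eq_re hI (ψ.comp (IsScalarTower.toAlgHom k R S)) fun r ↦
    Ideal.Quotient.eq_zero_iff_mem.1 (congrArg QuadraticAlgebra.im (π_ψ r))
  let _ : Algebra R B := f.toRingHom.toAlgebra
  have : IsScalarTower k R B := .of_algebraMap_eq fun c ↦ (f.commutes c).symm
  let gR : R' →ₐ[R] B ⧸ I :=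
    { g.toRingHom with
      commutes' r := (congrArg QuadraticAlgebra.re (π_ψ r)).symm.trans
        (congrArg (Ideal.Quotient.mk I) (hf r).symm) }
  obtain ⟨h, hh⟩ := (Algebra.FormallyEtale.comp_bijective R R' I hI).2 gR
  exact ⟨h.restrictScalars k, AlgHom.ext fun x ↦ DFunLike.congr_fun hh x⟩

end Smooth

/-! ### The sphere and its antipodal involution -/

instance {k S G : Type*} [CommRing k] [CommRing S] [Algebra k S] [Group G]
    [MulSemiringAction G S] [SMulCommClass G k S] :
    Algebra.IsInvariant (FixedPoints.subalgebra k S G) S G where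
  isInvariant s hs := ⟨⟨s, hs⟩, rfl⟩

theorem C₂_forall {p : C₂ → Prop} : (∀ g, p g) ↔ p 1 ∧ p (Multiplicative.ofAdd 1) :=
  Fin.forall_fin_two

theorem two_mul_algebraMap_half (B : Type*) [CommRing B] [Algebra ℝ B] :
    2 * algebraMap ℝ B (1 / 2) = 1 := by
  rw [← map_ofNat (algebraMap ℝ B) 2, ← map_mul, mul_one_div_cancel two_ne_zero, map_one]

namespace SphereRing

variable {r : ℕ}

section UniversalProperty

variable {A : Type*} [CommRing A] [Algebra ℝ A]

theorem algHom_ext {f g : SphereRing r →ₐ[ℝ] A} (h : ∀ i, f (z i) = g (z i)) : f = g :=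
  Ideal.Quotient.algHom_ext ℝ (MvPolynomial.algHom_ext h)

/-- The homomorphism from the coordinate ring of the sphere determined by a point of the sphere
with coordinates in `A`. -/
noncomputable def lift (y : Fin r → A) (hy : ∑ i, y i ^ 2 = 1) : SphereRing r →ₐ[ℝ] A :=
  Ideal.Quotient.liftₐ (sphereIdeal r) (aeval y) fun p hp ↦ by
    have : sphereIdeal r ≤ RingHom.ker (aeval (R := ℝ) y) :=
      (Ideal.span_singleton_le_iff_mem _).2 (RingHom.mem_ker.2 (by simp [hy]))
    exact this hp

theorem lift_mk (y : Fin r → A) (hy : ∑ i, y i ^ 2 = 1) (p : MvPolynomial (Fin r) ℝ) :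
    lift y hy (mk r p) = aeval y p :=
  rfl

theorem lift_z (y : Fin r → A) (hy : ∑ i, y i ^ 2 = 1) (i : Fin r) : lift y hy (z i) = y i :=
  aeval_X y i

end UniversalProperty

instance : Algebra.FormallySmooth ℝ (SphereRing r) := by
  refine .of_comp_surjective fun B _ _ I hI g ↦ ?_
  choose c hc using fun i ↦ Ideal.Quotient.mkₐ_surjective ℝ I (g (z i))
  obtain ⟨ε, sum_c⟩ : ∃ ε, ∑ i, c i ^ 2 = 1 + ε := ⟨_, (add_sub_cancel _ _).symm⟩
  have hε : Ideal.Quotient.mkₐ ℝ I ε = 0 := by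
    have := congrArg (Ideal.Quotient.mkₐ ℝ I) sum_c
    simp only [map_add, map_sum, map_pow, hc, map_one] at this
    simpa only [← map_pow, ← map_sum, sum_z_sq, map_one, left_eq_add] using this
  have hε_sq : ε * ε = 0 :=
    mul_eq_zero_of_sq_eq_bot hI (Ideal.Quotient.eq_zero_iff_mem.1 hε)
      (Ideal.Quotient.eq_zero_iff_mem.1 hε)
  obtain ⟨h, two_mul_h⟩ : ∃ h : B, 2 * h = 1 := ⟨_, two_mul_algebraMap_half B⟩
  have sum_sq : ∑ i, (c i * (1 - h * ε)) ^ 2 = 1 := by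
    simp only [mul_pow, ← Finset.sum_mul, sum_c]
    linear_combination (h ^ 2 + h ^ 2 * ε - 2 * h) * hε_sq - ε * two_mul_h
  exact ⟨lift _ sum_sq, algHom_ext fun i ↦ by
    rw [AlgHom.comp_apply, lift_z, map_mul, map_sub, map_mul, hε, hc, mul_zero, map_one, sub_zero,
      mul_one]⟩

theorem neg_z (i : Fin r) : neg r (z i) = -z i :=
  negHom_z i

theorem neg_neg (x : SphereRing r) : neg r (neg r x) = x :=
  DFunLike.congr_fun (neg_mul_neg r) x

theorem mem_fixed_iff {x : SphereRing r} : x ∈ Fixed r ↔ neg r x = x := by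
  refine C₂_forall.trans ?_
  rw [generator_smul, and_iff_right (one_smul C₂ x)]

theorem neg_coe (a : Fixed r) : neg r (a : SphereRing r) = a :=
  mem_fixed_iff.1 a.2

theorem isGaloisSystem (r : ℕ) : IsGaloisSystem C₂
    (fun i : Option (Fin r) ↦ (1 / 2 : ℝ) • i.elim (1 : SphereRing r) z) (fun i ↦ i.elim 1 z) := by
  have generator_ne_one : (Multiplicative.ofAdd 1 : C₂) ≠ 1 := by decide
  refine C₂_forall.2 ⟨?_, ?_⟩
  · simp only [one_smul, Fintype.sum_option, Option.elim, smul_mul_assoc, ← sq, ← Finset.smul_sum,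
      sum_z_sq, if_true]
    rw [one_pow, smul_add, ← add_smul, add_halves, one_smul]
  · simp only [smul_one, generator_smul_z, generator_ne_one, Fintype.sum_option, Option.elim,
      smul_mul_assoc, mul_neg, ← sq, Finset.sum_neg_distrib, ← Finset.smul_sum, sum_z_sq, if_false]
    rw [one_pow, add_neg_cancel, smul_zero]

instance : Module.Finite (Fixed r) (SphereRing r) :=
  (isGaloisSystem r).finite (Fixed r)

theorem isEtaleOfDegree_two (r : ℕ) : IsEtaleOfDegree (Fixed r) (SphereRing r) 2 :=
  (isGaloisSystem r).isEtaleOfDegree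

theorem adjoin_range_z (r : ℕ) : Algebra.adjoin ℝ (Set.range (z : Fin r → SphereRing r)) = ⊤ := by
  have h := congrArg (Subalgebra.map (mk r)) (MvPolynomial.adjoin_range_X (σ := Fin r) (R := ℝ))
  rwa [AlgHom.map_adjoin, Algebra.map_top, (AlgHom.range_eq_top _).2 (mk_surjective r),
    ← Set.range_comp] at h

theorem adjoin_fixed_range_z (r : ℕ) :
    Algebra.adjoin (Fixed r) (Set.range (z : Fin r → SphereRing r)) = ⊤ := by
  rw [← Algebra.adjoin_adjoin_of_tower ℝ, adjoin_range_z, Algebra.coe_top, Algebra.adjoin_univ]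


section FixedRing

/-- The even part `(x + neg x) / 2` of an element of `S`, as an element of the fixed ring. -/
noncomputable def evenPart (r : ℕ) : SphereRing r →ₗ[Fixed r] Fixed r :=
  (1 / 2 : ℝ) • invariantTrace (Fixed r) (SphereRing r) C₂

theorem coe_evenPart (x : SphereRing r) :
    (evenPart r x : SphereRing r) = (1 / 2 : ℝ) • (x + neg r x) := by
  have sum_smul : ∑ g : C₂, g • x = x + neg r x := by
    rw [← generator_smul, ← one_smul C₂ x, smul_smul, mul_one]
    exact Fin.sum_univ_two _
  exact congrArg ((1 / 2 : ℝ) • ·)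
    ((algebraMap_invariantTrace (Fixed r) (SphereRing r) C₂ x).trans sum_smul)

theorem evenPart_one : evenPart r 1 = 1 :=
  Subtype.ext (by
    rw [coe_evenPart, map_one, smul_add, ← add_smul, add_halves, one_smul]
    rfl)

/-- The element `zᵢ ^ 2` of the fixed ring. -/
noncomputable def zSq (i : Fin r) : Fixed r :=
  ⟨z i ^ 2, mem_fixed_iff.2 (by rw [map_pow, neg_z, neg_sq])⟩

theorem sum_zSq (r : ℕ) : ∑ i : Fin r, zSq i = 1 :=
  Subtype.ext ((map_sum (Fixed r).val zSq _).trans (sum_z_sq r))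

theorem evenPart_z (i : Fin r) : evenPart r (z i) = 0 :=
  Subtype.ext (by
    rw [coe_evenPart, neg_z, add_neg_cancel, smul_zero]
    rfl)

theorem zSq_mul_evenPart_mul (i : Fin r) (x y : SphereRing r) :
    zSq i * evenPart r (x * y) = zSq i * (evenPart r x * evenPart r y) +
      evenPart r (z i * x) * evenPart r (z i * y) := by
  ext
  simp only [zSq, Subalgebra.coe_mul, Subalgebra.coe_add, coe_evenPart, map_mul, neg_z,
    Algebra.smul_def]
  linear_combination (-z i ^ 2 * algebraMap ℝ (SphereRing r) (1 / 2) *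
    (x * y + neg r x * neg r y)) * two_mul_algebraMap_half (SphereRing r)

theorem evenPart_z_mul_mul (i : Fin r) (x y : SphereRing r) :
    evenPart r (z i * (x * y)) =
      evenPart r x * evenPart r (z i * y) + evenPart r (z i * x) * evenPart r y := by
  ext
  simp only [Subalgebra.coe_mul, Subalgebra.coe_add, coe_evenPart, map_mul, neg_z,
    Algebra.smul_def]
  linear_combination (-z i * algebraMap ℝ (SphereRing r) (1 / 2) *
    (x * y - neg r x * neg r y)) * two_mul_algebraMap_half (SphereRing r)

/-- The homomorphism from `S` to a quadratic algebra over the chart `zᵢ ≠ 0` of the quotient of the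
sphere that sends `zᵢ` to the generator `ω`. It comes from the decomposition
`x = evenPart x + (evenPart (zᵢ * x) / zᵢ ^ 2) * zᵢ`, valid where `zᵢ` is invertible. -/
noncomputable def toQuadraticAlgebra (i : Fin r) :
    SphereRing r →ₐ[Fixed r] QuadraticAlgebra (Localization.Away (zSq i))
      (algebraMap (Fixed r) (Localization.Away (zSq i)) (zSq i)) 0 :=
  let ι : Fixed r →ₐ[Fixed r] Localization.Away (zSq i) := Algebra.ofId _ _
  let u : Localization.Away (zSq i) := IsLocalization.Away.invSelf (zSq i)
  have mul_u : ι (zSq i) * u = 1 := IsLocalization.Away.mul_invSelf _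
  let re := ι.toLinearMap ∘ₗ evenPart r
  let im := LinearMap.mulLeft (Fixed r) u ∘ₗ re ∘ₗ LinearMap.mulLeft (Fixed r) (z i)
  .ofLinearMap
    { toFun x := ⟨re x, im x⟩
      map_add' x y := QuadraticAlgebra.ext (map_add re x y) (map_add im x y)
      map_smul' a x := QuadraticAlgebra.ext (map_smul re a x) (map_smul im a x) }
    (by
      refine QuadraticAlgebra.ext ?_ ?_
      · change ι (evenPart r 1) = 1
        rw [evenPart_one, map_one]
      · change u * ι (evenPart r (z i * 1)) = 0
        rw [mul_one, evenPart_z, map_zero, mul_zero])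
    (fun x y ↦ by
      have h := congrArg ι (zSq_mul_evenPart_mul i x y)
      have h' := congrArg ι (evenPart_z_mul_mul i x y)
      simp only [map_add, map_mul] at h h'
      refine QuadraticAlgebra.ext ?_ ?_
      · change ι (evenPart r (x * y)) = ι (evenPart r x) * ι (evenPart r y) +
          ι (zSq i) * (u * ι (evenPart r (z i * x))) * (u * ι (evenPart r (z i * y)))
        linear_combination u * h + (ι (evenPart r x) * ι (evenPart r y) - ι (evenPart r (x * y)) -
          u * ι (evenPart r (z i * x)) * ι (evenPart r (z i * y))) * mul_u
      · change u * ι (evenPart r (z i * (x * y))) =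
          ι (evenPart r x) * (u * ι (evenPart r (z i * y))) +
          (u * ι (evenPart r (z i * x))) * ι (evenPart r y) +
          0 * (u * ι (evenPart r (z i * x))) * (u * ι (evenPart r (z i * y)))
        linear_combination u * h')

instance : Algebra.FiniteType ℝ (SphereRing r) :=
  .of_surjective (mk r) (mk_surjective r)

instance : Algebra.FiniteType ℝ (Fixed r) :=
  ⟨fg_of_fg_of_fg ℝ (Fixed r) (SphereRing r) Algebra.FiniteType.out Module.Finite.fg_top
    (FaithfulSMul.algebraMap_injective _ _)⟩

theorem smooth_localizationAway_zSq (i : Fin r) :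
    Algebra.Smooth ℝ (Localization.Away (zSq i)) := by
  have : Algebra.FinitePresentation ℝ (Fixed r) :=
    Algebra.FinitePresentation.of_finiteType.1 inferInstance
  exact ⟨formallySmooth_of_algHom_quadraticAlgebra (toQuadraticAlgebra i), .trans ℝ (Fixed r) _⟩

instance : Algebra.Smooth ℝ (Fixed r) := by
  rw [← RingHom.smooth_algebraMap]
  refine RingHom.Smooth.ofLocalizationSpanTarget _ (Set.range (zSq (r := r))) ?_ ?_
  · rw [Ideal.eq_top_iff_one, ← sum_zSq]
    exact sum_mem fun i _ ↦ Ideal.subset_span ⟨i, rfl⟩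
  · rintro ⟨_, i, rfl⟩
    rw [← IsScalarTower.algebraMap_eq, RingHom.smooth_algebraMap]
    exact smooth_localizationAway_zSq i

end FixedRing

end SphereRing

/-! ### Krull dimension -/

section Dimension

variable {A B : Type*} [CommRing A] [CommRing B] [Algebra A B]

theorem ringKrullDim_le_of_hasGoingUp [Algebra.HasGoingUp A B]
    (h : Function.Surjective (PrimeSpectrum.comap (algebraMap A B))) :
    ringKrullDim A ≤ ringKrullDim B := by
  refine iSup_le fun l ↦ ?_
  obtain ⟨P, hP⟩ := h l.head
  have : P.asIdeal.LiesOver l.head.asIdeal := ⟨congrArg PrimeSpectrum.asIdeal hP.symm⟩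
  obtain ⟨L, hL, -⟩ := Ideal.exists_ltSeries_of_hasGoingUp l P.asIdeal
  exact hL ▸ Order.LTSeries.length_le_krullDim L

theorem ringKrullDim_eq_of_isIntegral [Algebra.IsIntegral A B] [FaithfulSMul A B] :
    ringKrullDim A = ringKrullDim B :=
  le_antisymm (ringKrullDim_le_of_hasGoingUp (Algebra.IsIntegral.comap_surjective A B))
    (Order.krullDim_le_of_strictMono (PrimeSpectrum.comap (algebraMap A B)) fun _ _ ↦
      Ideal.IsIntegral.comap_lt_comap)

end Dimension

namespace SphereRing

section Projection

variable (n : ℕ)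

/-- The projection of the `n`-sphere to the affine `n`-space that forgets the first coordinate. -/
noncomputable def tailHom : MvPolynomial (Fin n) ℝ →ₐ[ℝ] SphereRing (n + 1) :=
  aeval fun j ↦ z j.succ

/- The projection maps the sphere onto the unit ball, which contains an open cube. -/
theorem tailHom_injective : Function.Injective (tailHom n) := by
  rw [injective_iff_map_eq_zero]
  intro p hp
  have cube_infinite : (Set.Icc (0 : ℝ) (1 / (n + 1))).Infinite :=
    Set.Icc_infinite (by positivity)
  refine MvPolynomial.funext_set (fun _ ↦ Set.Icc (0 : ℝ) (1 / (n + 1)))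
    (fun _ ↦ cube_infinite) fun t ht ↦ ?_
  have sum_sq_le : ∑ j, t j ^ 2 ≤ 1 := by
    calc ∑ j, t j ^ 2 ≤ ∑ _j : Fin n, 1 / (n + 1 : ℝ) := Finset.sum_le_sum fun j _ ↦ by
          obtain ⟨h₀, h₁⟩ := ht j trivial
          have : (1 : ℝ) / (n + 1) ≤ 1 := (div_le_one (by positivity)).2 (by simp)
          nlinarith
      _ ≤ 1 := by
          rw [Finset.sum_const, Finset.card_univ, Fintype.card_fin, nsmul_eq_mul, mul_one_div,
            div_le_one (by positivity)]
          simp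
  have sum_cons : ∑ i, (Fin.cons √(1 - ∑ j, t j ^ 2) t : Fin (n + 1) → ℝ) i ^ 2 = 1 := by
    rw [Fin.sum_univ_succ]
    simp only [Fin.cons_zero, Fin.cons_succ]
    rw [Real.sq_sqrt (sub_nonneg.2 sum_sq_le), sub_add_cancel]
  have lift_tailHom : (lift _ sum_cons).comp (tailHom n) = aeval t :=
    MvPolynomial.algHom_ext fun j ↦ by
      rw [AlgHom.comp_apply, tailHom, aeval_X, aeval_X, lift_z, Fin.cons_succ]
  rw [map_zero, ← aeval_eq_eval]
  exact (DFunLike.congr_fun lift_tailHom p).symm.trans ((congrArg _ hp).trans (map_zero _))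

theorem tailHom_isIntegral : (tailHom n).toRingHom.IsIntegral := by
  algebraize [(tailHom n).toRingHom]
  have : IsScalarTower ℝ (MvPolynomial (Fin n) ℝ) (SphereRing (n + 1)) :=
    .of_algebraMap_eq fun c ↦ ((tailHom n).commutes c).symm
  have isIntegral_z_succ (j : Fin n) :
      IsIntegral (MvPolynomial (Fin n) ℝ) (z j.succ : SphereRing (n + 1)) := by
    rw [← (aeval_X _ j : tailHom n (X j) = z j.succ)]
    exact isIntegral_algebraMap
  have isIntegral_z_zero : IsIntegral (MvPolynomial (Fin n) ℝ) (z 0 : SphereRing (n + 1)) := by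
    have h := sum_z_sq (n + 1)
    rw [Fin.sum_univ_succ] at h
    refine IsIntegral.of_pow two_pos ?_
    rw [eq_sub_of_add_eq h]
    exact isIntegral_one.sub (IsIntegral.sum _ fun j _ ↦ (isIntegral_z_succ j).pow 2)
  have adjoin_le : Algebra.adjoin ℝ (Set.range z) ≤
      (integralClosure (MvPolynomial (Fin n) ℝ) (SphereRing (n + 1))).restrictScalars ℝ :=
    Algebra.adjoin_le (Set.range_subset_iff.2 (Fin.cases isIntegral_z_zero isIntegral_z_succ))
  rw [adjoin_range_z] at adjoin_le
  exact fun x ↦ adjoin_le trivial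

theorem ringKrullDim_succ : ringKrullDim (SphereRing (n + 1)) = n := by
  algebraize [(tailHom n).toRingHom]
  have : Algebra.IsIntegral (MvPolynomial (Fin n) ℝ) (SphereRing (n + 1)) :=
    ⟨tailHom_isIntegral n⟩
  have : FaithfulSMul (MvPolynomial (Fin n) ℝ) (SphereRing (n + 1)) :=
    (faithfulSMul_iff_algebraMap_injective _ _).2 (tailHom_injective n)
  rw [← ringKrullDim_eq_of_isIntegral (A := MvPolynomial (Fin n) ℝ),
    ringKrullDim_of_isNoetherianRing, ringKrullDim_eq_zero_of_field, zero_add, Nat.card_fin]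

theorem ringKrullDim_fixed_succ : ringKrullDim (Fixed (n + 1)) = n := by
  rw [ringKrullDim_eq_of_isIntegral (B := SphereRing (n + 1)), ringKrullDim_succ]

end Projection

end SphereRing

/-! ### Generators -/

section Coprime

variable {P A B : Type*} [CommRing P] [CommRing A] [CommRing B]

theorem isCoprime_ker_of_isUnit {g : P →+* B} (hg : Function.Surjective g) {I : Ideal P} {p : P}
    (hp : p ∈ I) (h : IsUnit (g p)) : IsCoprime I (RingHom.ker g) := by
  obtain ⟨q, hq⟩ := hg ↑h.unit⁻¹
  refine Ideal.isCoprime_iff_exists.2 ⟨q * p, I.mul_mem_left q hp, 1 - q * p, ?_,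
    add_sub_cancel _ _⟩
  rw [RingHom.mem_ker, map_sub, map_mul, hq, h.val_inv_mul, map_one, sub_self]

theorem prod_surjective_of_isCoprime_ker {f : P →+* A} {g : P →+* B}
    (hf : Function.Surjective f) (hg : Function.Surjective g)
    (h : IsCoprime (RingHom.ker f) (RingHom.ker g)) : Function.Surjective (f.prod g) := by
  obtain ⟨u, hu, v, hv, huv⟩ := Ideal.isCoprime_iff_exists.1 h
  rintro ⟨a, b⟩
  obtain ⟨s, rfl⟩ := hf a
  obtain ⟨t, rfl⟩ := hg b
  refine ⟨s * v + t * u, Prod.ext ?_ ?_⟩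
  · have : f v = 1 := by rw [← map_one f, ← huv, map_add, hu, zero_add]
    simp [this, RingHom.mem_ker.1 hu]
  · have : g u = 1 := by rw [← map_one g, ← huv, map_add, hv, add_zero]
    simp [this, RingHom.mem_ker.1 hv]

theorem pi_surjective_of_isCoprime_ker {ι : Type*} [Finite ι] {g : ι → P →+* B}
    (hg : ∀ i, Function.Surjective (g i))
    (h : Pairwise (Function.onFun IsCoprime fun i ↦ RingHom.ker (g i))) :
    Function.Surjective (RingHom.pi g) := fun b ↦ by
  choose p hp using fun i ↦ hg i (b i)
  obtain ⟨q, hq⟩ := Ideal.exists_forall_sub_mem_ideal h p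
  exact ⟨q, funext fun i ↦ ((RingHom.sub_mem_ker_iff (g i)).1 (hq i)).trans (hp i)⟩

end Coprime

section IsGeneratedBy

variable {R A B : Type*} [CommRing R] [CommRing A] [CommRing B] [Algebra R A] [Algebra R B] {m : ℕ}

theorem isGeneratedBy_iff_exists_surjective :
    IsGeneratedBy R A m ↔ ∃ f : MvPolynomial (Fin m) R →ₐ[R] A, Function.Surjective f := by
  refine ⟨fun ⟨a, ha⟩ ↦ ⟨aeval a, ?_⟩, fun ⟨f, hf⟩ ↦ ⟨f ∘ X, ?_⟩⟩
  · rwa [← AlgHom.range_eq_top, ← Algebra.adjoin_range_eq_range_aeval]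
  · rw [Algebra.adjoin_range_eq_range_aeval, ← aeval_unique, AlgHom.range_eq_top]
    exact hf

theorem IsGeneratedBy.of_surjective (h : IsGeneratedBy R A m) (f : A →ₐ[R] B)
    (hf : Function.Surjective f) : IsGeneratedBy R B m := by
  obtain ⟨g, hg⟩ := isGeneratedBy_iff_exists_surjective.1 h
  exact isGeneratedBy_iff_exists_surjective.2 ⟨f.comp g, hf.comp hg⟩

/- The algebra `A × (ι → R)` is the coordinate ring of a disjoint union in affine `m`-space over
`R`: the closed subscheme `Spec A` and the sections `x i`. -/
theorem isGeneratedBy_prod_pi {ι : Type*} [Finite ι] {a : Fin m → A}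
    (ha : Algebra.adjoin R (Set.range a) = ⊤) {p : MvPolynomial (Fin m) R} (hp : aeval a p = 0)
    {x : ι → Fin m → R} (hx : ∀ i, IsUnit (eval (x i) p))
    (hx' : Pairwise fun i j ↦ ∃ l, IsUnit (x j l - x i l)) :
    IsGeneratedBy R (A × (ι → R)) m := by
  let _ := Fintype.ofFinite ι
  have aeval_surjective : Function.Surjective (aeval a : MvPolynomial (Fin m) R →ₐ[R] A) := by
    rw [← AlgHom.range_eq_top, ← Algebra.adjoin_range_eq_range_aeval, ha]
  have eval_surjective (i : ι) : Function.Surjective (eval (x i)) := fun c ↦ ⟨C c, eval_C c⟩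
  have isCoprime_ker_eval :
      Pairwise (Function.onFun IsCoprime fun i ↦ RingHom.ker (eval (x i))) := fun i j hij ↦ by
    obtain ⟨l, hl⟩ := hx' hij
    refine isCoprime_ker_of_isUnit (eval_surjective j) (p := X l - C (x i l)) ?_ ?_
    · simp
    · simpa using hl
  have isCoprime_ker_aeval : IsCoprime (RingHom.ker (aeval a : MvPolynomial (Fin m) R →ₐ[R] A))
      (RingHom.ker (RingHom.pi fun i ↦ eval (x i))) := by
    rw [Pi.ker_ringHom]
    simpa using Ideal.isCoprime_biInf (s := Finset.univ) fun i _ ↦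
      isCoprime_ker_of_isUnit (eval_surjective i) (RingHom.mem_ker.2 hp) (hx i)
  have surjective := prod_surjective_of_isCoprime_ker aeval_surjective
    (pi_surjective_of_isCoprime_ker eval_surjective isCoprime_ker_eval) isCoprime_ker_aeval
  refine isGeneratedBy_iff_exists_surjective.2
    ⟨(aeval a).prod (AlgHom.pi fun i ↦ aeval (x i)), fun y ↦ (surjective y).imp fun q hq ↦ ?_⟩
  rw [← hq]
  exact Prod.ext rfl (funext fun i ↦ congrFun (aeval_eq_eval _) q)

end IsGeneratedBy

theorem SphereRing.isGeneratedBy_prod (n k : ℕ) :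
    IsGeneratedBy (Fixed (n + 1)) (SphereRing (n + 1) × (Fin k → Fixed (n + 1))) (n + 1) := by
  let R := Fixed (n + 1)
  let t (j : Fin k) : ℝ := j + 2
  refine isGeneratedBy_prod_pi (adjoin_fixed_range_z (n + 1)) (p := ∑ i, X i ^ 2 - 1)
    (x := fun j ↦ Pi.single (0 : Fin (n + 1)) (algebraMap ℝ R (t j))) ?_ (fun j ↦ ?_)
    fun i j hij ↦ ⟨0, ?_⟩
  · simp [sum_z_sq]
  · have eval_eq : eval (Pi.single (0 : Fin (n + 1)) (algebraMap ℝ R (t j))) (∑ i, X i ^ 2 - 1) =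
        algebraMap ℝ R (t j ^ 2 - 1) := by
      simp [Fin.sum_univ_succ]
    have : (0 : ℝ) ≤ j := Nat.cast_nonneg _
    rw [eval_eq]
    exact (IsUnit.mk0 _ (by simp only [t]; nlinarith)).map _
  · rw [Pi.single_eq_same, Pi.single_eq_same, ← map_sub]
    exact (IsUnit.mk0 _ (sub_ne_zero.2 (by simpa [t, Fin.val_inj] using hij.symm))).map _

/-! ### Real points of odd-dimensional algebras -/

section OddDimension

variable {K A : Type*} [Field K] [CommRing A] [Algebra K A]

theorem dvd_finrank_of_isFiniteLength {d : ℕ}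
    (h : ∀ I : Ideal A, I.IsMaximal → d ∣ Module.finrank K (A ⧸ I)) {M : Type*} [AddCommGroup M]
    [Module A M] (hM : IsFiniteLength A M) :
    ∀ [Module K M] [IsScalarTower K A M] [Module.Finite K M], d ∣ Module.finrank K M := by
  induction hM with
  | of_subsingleton => simp [Module.finrank_zero_of_subsingleton]
  | @of_simple_quotient M _ _ N hN _ ih =>
    intro _ _ _
    have : Module.Finite K N := .of_injective (N.subtype.restrictScalars K) N.subtype_injective
    obtain ⟨I, hI, ⟨e⟩⟩ := isSimpleModule_iff_quot_maximal.1 hN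
    have finrank_add : Module.finrank K (M ⧸ N) + Module.finrank K N = Module.finrank K M :=
      Submodule.finrank_quotient_add_finrank (N.restrictScalars K)
    rw [← finrank_add, (e.restrictScalars K).finrank_eq]
    exact dvd_add (h I hI) ih

theorem dvd_finrank_of_forall_isMaximal [Module.Finite K A] {d : ℕ}
    (h : ∀ I : Ideal A, I.IsMaximal → d ∣ Module.finrank K (A ⧸ I)) : d ∣ Module.finrank K A := by
  have := IsArtinianRing.of_finite K A
  exact dvd_finrank_of_isFiniteLength h (isFiniteLength_iff_isNoetherian_isArtinian.2
    ⟨inferInstance, inferInstance⟩)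

theorem nonempty_algHom_real_of_odd_finrank [Algebra ℝ A] (h : Odd (Module.finrank ℝ A)) :
    Nonempty (A →ₐ[ℝ] ℝ) := by
  have : Module.Finite ℝ A := Module.finite_of_finrank_pos h.pos
  by_contra hA
  refine Nat.not_even_iff_odd.2 h (even_iff_two_dvd.2 <| dvd_finrank_of_forall_isMaximal
    fun I hI ↦ ?_)
  let _ := Ideal.Quotient.field I
  obtain ⟨⟨e⟩⟩ | ⟨⟨e⟩⟩ := Real.nonempty_algEquiv_or (A ⧸ I)
  · exact (hA ⟨e.toAlgHom.comp (Ideal.Quotient.mkₐ ℝ I)⟩).elim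
  · rw [e.toLinearEquiv.finrank_eq, Complex.finrank_real_complex]

end OddDimension

/-! ### Deformations of complete intersections -/

section LinearAlgebra

variable {K M : Type*} [AddCommGroup M]

theorem surjective_of_injective_of_forall_le_comap [Field K] [Module K M] (f : M →ₗ[K] M)
    (hf : Function.Injective f)
    (h : ∀ x, ∃ N : Submodule K M, Module.Finite K N ∧ x ∈ N ∧ N ≤ N.comap f) :
    Function.Surjective f := fun x ↦ by
  obtain ⟨N, _, hx, hN⟩ := h x
  have : Function.Injective (f.restrict hN) := fun a b hab ↦
    Subtype.ext (hf (congrArg Subtype.val hab))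
  obtain ⟨y, hy⟩ := LinearMap.injective_iff_surjective.1 this ⟨x, hx⟩
  exact ⟨y, congrArg Subtype.val hy⟩

variable [CommRing K] [IsDomain K] [Module K M] {ι : Type*} [DecidableEq ι]

theorem linearIndependent_of_det_submatrix_ne_zero (e : Module.Basis ι K M) {v : ι → M}
    (h : ∀ J : Finset ι, ((e.toMatrix v).submatrix ((↑) : J → ι) (↑)).det ≠ 0) :
    LinearIndependent K v := by
  refine linearIndependent_iff'.2 fun J l hl i hi ↦ ?_
  refine congrFun (Matrix.eq_zero_of_mulVec_eq_zero (h J) (v := fun j ↦ l j) ?_) ⟨i, hi⟩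
  ext a
  have := DFunLike.congr_fun (congrArg e.repr hl) a.1
  simp only [map_sum, map_smul, Finsupp.finsetSum_apply, Finsupp.smul_apply, smul_eq_mul,
    map_zero, Finsupp.zero_apply] at this
  rw [Pi.zero_apply, ← this, ← J.sum_coe_sort]
  exact Finset.sum_congr rfl fun j _ ↦ mul_comm _ _

theorem exists_countable_forall_det_submatrix_ne_zero [Countable ι]
    (P : Matrix ι ι (Polynomial K)) (hP : P.map (Polynomial.eval 0) = 1) :
    ∃ S : Set K, S.Countable ∧ ∀ s ∉ S, ∀ J : Finset ι,
      ((P.map (Polynomial.eval s)).submatrix ((↑) : J → ι) (↑)).det ≠ 0 := by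
  let D (J : Finset ι) : Polynomial K := (P.submatrix ((↑) : J → ι) (↑)).det
  have eval_D (s : K) (J : Finset ι) :
      (D J).eval s = ((P.map (Polynomial.eval s)).submatrix ((↑) : J → ι) (↑)).det :=
    RingHom.map_det (Polynomial.evalRingHom s) _
  have D_ne_zero (J : Finset ι) : D J ≠ 0 := fun h ↦ by
    have := eval_D 0 J
    rw [h, hP, Matrix.submatrix_one _ Subtype.val_injective] at this
    simp at this
  refine ⟨⋃ J, {s | (D J).IsRoot s}, Set.countable_iUnion fun J ↦
    (Polynomial.finite_setOfPred_isRoot (D_ne_zero J)).countable, fun s hs J h ↦ ?_⟩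
  exact hs (Set.mem_iUnion.2 ⟨J, (eval_D s J).trans h⟩)

end LinearAlgebra

section Deform

variable {σ K : Type*}

section CommRing

variable [CommRing K] {d : σ → ℕ}

/-- The deformation `X i ^ d i + s f i` of the complete intersection of powers of the variables. -/
noncomputable def deform (d : σ → ℕ) (f : σ → MvPolynomial σ K) (s : K) (i : σ) :
    MvPolynomial σ K :=
  X i ^ d i + C s * f i

theorem totalDegree_deform_le [Nontrivial K] {f : σ → MvPolynomial σ K}
    (hf : ∀ i, (f i).totalDegree ≤ d i) (s : K) (i : σ) :
    (deform d f s i).totalDegree ≤ d i := by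
  refine (totalDegree_add _ _).trans (max_le (totalDegree_X_pow i _).le ?_)
  refine (totalDegree_mul _ _).trans ?_
  rw [totalDegree_C, zero_add]
  exact hf i

theorem map_deform {L : Type*} [CommRing L] (φ : K →+* L) (d : σ → ℕ) (f : σ → MvPolynomial σ K)
    (s : K) (i : σ) : map φ (deform d f s i) = deform d (fun i ↦ map φ (f i)) (φ s) i := by
  simp [deform]

section Fintype

variable [Fintype σ]

/-- The monomial with exponents `a i % d i` in the variables and `a i / d i` in the polynomials
`g i`. If `g i` is a small perturbation of `X i ^ d i`, this is a perturbation of the monomial with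
exponent `a`. -/
noncomputable def divModMonomial (g : σ → MvPolynomial σ K) (d : σ → ℕ) (a : σ →₀ ℕ) :
    MvPolynomial σ K :=
  ∏ i, X i ^ (a i % d i) * g i ^ (a i / d i)

theorem map_divModMonomial {L : Type*} [CommRing L] (φ : K →+* L) (g : σ → MvPolynomial σ K)
    (d : σ → ℕ) (a : σ →₀ ℕ) :
    map φ (divModMonomial g d a) = divModMonomial (fun i ↦ map φ (g i)) d a := by
  simp [divModMonomial]

theorem divModMonomial_X_pow (d : σ → ℕ) (a : σ →₀ ℕ) :
    divModMonomial (fun i ↦ (X i ^ d i : MvPolynomial σ K)) d a = monomial a 1 := by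
  rw [monomial_eq, C_1, one_mul, divModMonomial, Finsupp.prod_fintype _ _ fun _ ↦ pow_zero _]
  refine Finset.prod_congr rfl fun i _ ↦ ?_
  rw [← pow_mul, ← pow_add, Nat.mod_add_div]

theorem divModMonomial_add_single (g : σ → MvPolynomial σ K) {i : σ} (hd : 0 < d i)
    (a : σ →₀ ℕ) :
    divModMonomial g d (a + Finsupp.single i (d i)) = g i * divModMonomial g d a := by
  classical
  rw [divModMonomial, divModMonomial, ← Finset.mul_prod_erase _ _ (Finset.mem_univ i),
    ← Finset.mul_prod_erase _ _ (Finset.mem_univ i), ← mul_assoc]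
  congr 1
  · rw [Finsupp.add_apply, Finsupp.single_eq_same, Nat.add_mod_right, Nat.add_div_right _ hd]
    ring
  · refine Finset.prod_congr rfl fun j hj ↦ ?_
    rw [Finsupp.add_apply, Finsupp.single_eq_of_ne (Finset.ne_of_mem_erase hj), add_zero]

theorem totalDegree_divModMonomial_le [Nontrivial K] {g : σ → MvPolynomial σ K}
    (hg : ∀ i, (g i).totalDegree ≤ d i) (a : σ →₀ ℕ) :
    (divModMonomial g d a).totalDegree ≤ a.degree := by
  rw [divModMonomial, Finsupp.degree_eq_sum]
  refine (totalDegree_finsetProd _ _).trans (Finset.sum_le_sum fun i _ ↦ ?_)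
  calc (X i ^ (a i % d i) * g i ^ (a i / d i)).totalDegree
      ≤ a i % d i + a i / d i * d i := by
        refine (totalDegree_mul _ _).trans (add_le_add (totalDegree_X_pow i _).le ?_)
        exact (totalDegree_pow _ _).trans (Nat.mul_le_mul_left _ (hg i))
    _ = a i := Nat.mod_add_div' _ _

end Fintype

theorem map_span_range_eq_of_map_mul {ι A B : Type*} [Finite ι] [CommRing A] [CommRing B]
    [Algebra K A] [Algebra K B] (T : A ≃ₗ[K] B) {x : ι → A} {y : ι → B}
    (h : ∀ i a, T (x i * a) = y i * T a) :
    ((Ideal.span (Set.range x)).restrictScalars K).map (T : A →ₗ[K] B) =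
      (Ideal.span (Set.range y)).restrictScalars K := by
  let _ := Fintype.ofFinite ι
  have map_sum_mul (c : ι → A) : T (∑ i, c i * x i) = ∑ i, T (c i) * y i := by
    simp only [map_sum, mul_comm _ (x _), mul_comm _ (y _), h]
  ext b
  simp only [Submodule.mem_map, Submodule.restrictScalars_mem, Ideal.mem_span_range_iff_exists_fun]
  constructor
  · rintro ⟨_, ⟨c, rfl⟩, rfl⟩
    exact ⟨fun i ↦ T (c i), (map_sum_mul c).symm⟩
  · rintro ⟨c, rfl⟩
    exact ⟨_, ⟨fun i ↦ T.symm (c i), rfl⟩, (map_sum_mul _).trans (by simp)⟩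

theorem mem_span_range_X_pow_iff {p : MvPolynomial σ K} :
    p ∈ Ideal.span (Set.range fun i ↦ (X i ^ d i : MvPolynomial σ K)) ↔
      ∀ a : σ →₀ ℕ, (∀ i, a i < d i) → coeff a p = 0 := by
  have range_eq : (Set.range fun i ↦ (X i ^ d i : MvPolynomial σ K)) =
      (fun a ↦ monomial a 1) '' Set.range fun i ↦ Finsupp.single i (d i) := by
    rw [← Set.range_comp]
    exact congrArg Set.range (funext fun i ↦ X_pow_eq_monomial)
  rw [range_eq, mem_ideal_span_monomial_image]
  simp only [Set.exists_range_iff, Finsupp.single_le_iff, mem_support_iff]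
  refine forall_congr' fun a ↦ ?_
  contrapose!
  exact and_comm

variable [Fintype σ]

theorem exists_countable_linearIndependent_divModMonomial [IsDomain K] (d : σ → ℕ)
    (f : σ → MvPolynomial σ K) : ∃ S : Set K, S.Countable ∧
      ∀ s ∉ S, LinearIndependent K (divModMonomial (deform d f s) d) := by
  classical
  let v := divModMonomial (deform d (fun i ↦ map Polynomial.C (f i)) Polynomial.X) d
  have map_v (s : K) (a : σ →₀ ℕ) :
      map (Polynomial.evalRingHom s) (v a) = divModMonomial (deform d f s) d a := by
    have : (Polynomial.evalRingHom s).comp Polynomial.C = RingHom.id K := by ext; simp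
    rw [map_divModMonomial]
    congr 1
    funext i
    rw [map_deform]
    simp only [map_map, this, map_id, Polynomial.coe_evalRingHom, Polynomial.eval_X]
  let P : Matrix (σ →₀ ℕ) (σ →₀ ℕ) (Polynomial K) := .of fun a c ↦ coeff a (v c)
  have map_P (s : K) : P.map (Polynomial.eval s) =
      (basisMonomials σ K).toMatrix (divModMonomial (deform d f s) d) := by
    ext a c
    exact (coeff_map (Polynomial.evalRingHom s) (v c) a).symm.trans (congrArg (coeff a) (map_v s c))
  have deform_zero : deform d f 0 = fun i ↦ X i ^ d i := by
    funext i
    simp [deform]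
  obtain ⟨S, hS, hdet⟩ := exists_countable_forall_det_submatrix_ne_zero P <| by
    rw [map_P, deform_zero, funext (divModMonomial_X_pow d), ← coe_basisMonomials,
      Module.Basis.toMatrix_self]
  exact ⟨S, hS, fun s hs ↦ linearIndependent_of_det_submatrix_ne_zero (basisMonomials σ K)
    fun J ↦ map_P s ▸ hdet s hs J⟩

variable (K d) in
/-- The coefficients at the exponents below `d`, which identify the quotient by the powers
`X i ^ d i` with a free module. -/
noncomputable def coeffBelow :
    MvPolynomial σ K →ₗ[K] ((i : σ) → Fin (d i)) → K :=
  LinearMap.pi fun c ↦ lcoeff K (Finsupp.equivFunOnFinite.symm fun i ↦ (c i : ℕ))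

theorem coeffBelow_surjective : Function.Surjective (coeffBelow K d) := fun v ↦ by
  classical
  refine ⟨∑ c, monomial (Finsupp.equivFunOnFinite.symm fun i ↦ (c i : ℕ)) (v c), ?_⟩
  ext c
  have (c' : (i : σ) → Fin (d i)) : (fun i ↦ (c' i : ℕ)) = (fun i ↦ (c i : ℕ)) ↔ c' = c := by
    simp only [funext_iff, Fin.val_inj]
  simp [coeffBelow, coeff_monomial, this]

theorem ker_coeffBelow : LinearMap.ker (coeffBelow K d) =
    (Ideal.span (Set.range fun i ↦ (X i ^ d i : MvPolynomial σ K))).restrictScalars K := by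
  ext p
  rw [Submodule.restrictScalars_mem, mem_span_range_X_pow_iff, LinearMap.mem_ker, funext_iff]
  refine ⟨fun h a ha ↦ ?_, fun h c ↦ h _ fun i ↦ (c i).2⟩
  have : coeff (Finsupp.equivFunOnFinite.symm a) p = 0 := h fun i ↦ ⟨a i, ha i⟩
  rwa [Finsupp.equivFunOnFinite_symm_coe] at this

end CommRing

variable [Field K] [Fintype σ] {d : σ → ℕ}

theorem exists_linearEquiv_monomial_eq_divModMonomial {g : σ → MvPolynomial σ K}
    (hg : ∀ i, (g i).totalDegree ≤ d i) (h : LinearIndependent K (divModMonomial g d)) :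
    ∃ T : MvPolynomial σ K ≃ₗ[K] MvPolynomial σ K,
      ∀ a, T (monomial a 1) = divModMonomial g d a := by
  let T := Finsupp.linearCombination K (divModMonomial g d) ∘ₗ (basisMonomials σ K).repr.toLinearMap
  have T_monomial (a : σ →₀ ℕ) : T (monomial a 1) = divModMonomial g d a := by
    change Finsupp.linearCombination K _ (Finsupp.single a 1) = _
    rw [Finsupp.linearCombination_single, one_smul]
  have T_apply (p : MvPolynomial σ K) :
      T p = ∑ a ∈ p.support, coeff a p • divModMonomial g d a := by
    conv_lhs => rw [p.as_sum, map_sum]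
    refine Finset.sum_congr rfl fun a _ ↦ ?_
    rw [← T_monomial, ← map_smul, smul_monomial, smul_eq_mul, mul_one]
  have T_injective : Function.Injective T :=
    Function.Injective.comp (g := Finsupp.linearCombination K _) h
      (basisMonomials σ K).repr.injective
  refine ⟨.ofBijective T ⟨T_injective, surjective_of_injective_of_forall_le_comap T T_injective
    fun p ↦ ⟨restrictTotalDegree σ K p.totalDegree, inferInstance,
      (mem_restrictTotalDegree _ _ _).2 le_rfl, fun q hq ↦ ?_⟩⟩, T_monomial⟩
  rw [Submodule.mem_comap, T_apply]
  refine sum_mem fun a ha ↦ Submodule.smul_mem _ _ ?_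
  rw [mem_restrictTotalDegree] at hq ⊢
  exact (totalDegree_divModMonomial_le hg a).trans ((le_totalDegree ha).trans hq)

theorem exists_countable_finrank_quotient_deform (hd : ∀ i, 0 < d i)
    {f : σ → MvPolynomial σ K} (hf : ∀ i, (f i).totalDegree ≤ d i) :
    ∃ S : Set K, S.Countable ∧ ∀ s ∉ S, Module.finrank K
      (MvPolynomial σ K ⧸ Ideal.span (Set.range (deform d f s))) = ∏ i, d i := by
  classical
  obtain ⟨S, hS, h⟩ := exists_countable_linearIndependent_divModMonomial d f
  refine ⟨S, hS, fun s hs ↦ ?_⟩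
  obtain ⟨T, hT⟩ :=
    exists_linearEquiv_monomial_eq_divModMonomial (totalDegree_deform_le hf s) (h s hs)
  have T_mul (i : σ) (p : MvPolynomial σ K) : T (X i ^ d i * p) = deform d f s i * T p := by
    refine LinearMap.congr_fun ((basisMonomials σ K).ext fun a ↦ ?_ :
      T.toLinearMap ∘ₗ .mulLeft K (X i ^ d i) = .mulLeft K (deform d f s i) ∘ₗ T.toLinearMap) p
    simp [X_pow_eq_monomial, hT, add_comm _ a, divModMonomial_add_single _ (hd i)]
  let e : (MvPolynomial σ K ⧸ Ideal.span (Set.range (deform d f s))) ≃ₗ[K]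
      (((i : σ) → Fin (d i)) → K) :=
    (Submodule.Quotient.equiv _ _ T (map_span_range_eq_of_map_mul T T_mul)).symm ≪≫ₗ
      Submodule.quotEquivOfEq _ _ ker_coeffBelow.symm ≪≫ₗ
      (coeffBelow K d).quotKerEquivOfSurjective coeffBelow_surjective
  rw [e.finrank_eq, Module.finrank_fintype_fun_eq_card, Fintype.card_pi]
  simp

end Deform

/-! ### The Borsuk–Ulam theorem for polynomials -/

section BorsukUlam

theorem aeval_mul_of_isHomogeneous {σ K A : Type*} [CommSemiring K] [CommSemiring A]
    [Algebra K A] {p : MvPolynomial σ K} {m : ℕ} (hp : p.IsHomogeneous m) (t : A) (x : σ → A) :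
    aeval (fun i ↦ t * x i) p = t ^ m * aeval x p := by
  simp only [aeval_def, eval₂_eq, Finset.mul_sum]
  refine Finset.sum_congr rfl fun a ha ↦ ?_
  have sum_eq : ∑ i ∈ a.support, a i = m := (hp.degree_eq_sum_deg_support ha).symm
  simp_rw [mul_pow, Finset.prod_mul_distrib]
  rw [Finset.prod_pow_eq_pow_sum, sum_eq, mul_left_comm]

theorem totalDegree_aeval_le {σ τ K : Type*} [CommSemiring K] {v : σ → MvPolynomial τ K}
    (hv : ∀ i, (v i).totalDegree ≤ 1) (p : MvPolynomial σ K) :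
    (aeval v p).totalDegree ≤ p.totalDegree := by
  rw [aeval_def, eval₂_eq]
  refine totalDegree_finsetSum_le fun a ha ↦ (totalDegree_mul _ _).trans ?_
  rw [algebraMap_eq, totalDegree_C, zero_add]
  refine (totalDegree_finsetProd _ _).trans (le_trans ?_ (le_totalDegree ha))
  refine Finset.sum_le_sum fun i _ ↦ (totalDegree_pow _ _).trans ?_
  simpa using Nat.mul_le_mul_left (a i) (hv i)

theorem exists_eval_eq_zero_of_odd_finrank_quotient {σ ι : Type*} {g : ι → MvPolynomial σ ℝ}
    (h : Odd (Module.finrank ℝ (MvPolynomial σ ℝ ⧸ Ideal.span (Set.range g)))) :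
    ∃ x : σ → ℝ, ∀ i, eval x (g i) = 0 := by
  obtain ⟨φ⟩ := nonempty_algHom_real_of_odd_finrank h
  let π := Ideal.Quotient.mkₐ ℝ (Ideal.span (Set.range g))
  refine ⟨fun j ↦ φ (π (X j)), fun i ↦ ?_⟩
  have π_g : π (g i) = 0 := Ideal.Quotient.eq_zero_iff_mem.2 (Ideal.subset_span ⟨i, rfl⟩)
  rw [← aeval_eq_eval]
  exact (DFunLike.congr_fun (aeval_unique (φ.comp π)) (g i)).symm.trans (by simp [π_g])

theorem exists_sum_sq_eq_one_and_eval_eq_zero_of_ne_zero {σ ι : Type*} [Fintype σ]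
    {F : ι → MvPolynomial σ ℝ} {d : ι → ℕ} (hF : ∀ i, (F i).IsHomogeneous (d i)) {v : σ → ℝ}
    (hv : v ≠ 0) (h : ∀ i, eval v (F i) = 0) :
    ∃ u : σ → ℝ, ∑ j, u j ^ 2 = 1 ∧ ∀ i, eval u (F i) = 0 := by
  have sum_pos : 0 < ∑ j, v j ^ 2 := by
    obtain ⟨j, hj⟩ := Function.ne_iff.1 hv
    exact Finset.sum_pos' (fun j _ ↦ sq_nonneg _) ⟨j, Finset.mem_univ j, sq_pos_of_ne_zero hj⟩
  refine ⟨fun j ↦ (√(∑ j, v j ^ 2))⁻¹ * v j, ?_, fun i ↦ ?_⟩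
  · simp_rw [mul_pow]
    rw [← Finset.mul_sum, inv_pow, Real.sq_sqrt sum_pos.le, inv_mul_cancel₀ sum_pos.ne']
  · rw [← aeval_eq_eval, aeval_mul_of_isHomogeneous (hF i), aeval_eq_eval, h i, mul_zero]

variable {n : ℕ} {d : Fin n → ℕ}

/- In the affine chart where the first coordinate is `1`, the forms become the deformation of
`X i ^ d i`. -/
theorem exists_countable_exists_pow_add_mul_eval_eq_zero (hd : ∀ i, Odd (d i))
    {F : Fin n → MvPolynomial (Fin (n + 1)) ℝ} (hF : ∀ i, (F i).IsHomogeneous (d i)) :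
    ∃ S : Set ℝ, S.Countable ∧ ∀ s ∉ S, ∃ u : Fin (n + 1) → ℝ, ∑ j, u j ^ 2 = 1 ∧
      ∀ i, u i.succ ^ d i + s * eval u (F i) = 0 := by
  let w : Fin (n + 1) → MvPolynomial (Fin n) ℝ := Fin.cons 1 X
  have totalDegree_w (j : Fin (n + 1)) : (w j).totalDegree ≤ 1 := by
    cases j using Fin.cases <;> simp [w]
  have eval_aeval_w (x : Fin n → ℝ) (p : MvPolynomial (Fin (n + 1)) ℝ) :
      eval x (aeval w p) = eval (Fin.cons 1 x : Fin (n + 1) → ℝ) p := by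
    rw [← aeval_eq_eval, ← aeval_eq_eval, ← AlgHom.comp_apply]
    congr 1
    ext j
    cases j using Fin.cases <;> simp [w]
  obtain ⟨S, hS, h⟩ := exists_countable_finrank_quotient_deform (fun i ↦ (hd i).pos)
    (f := fun i ↦ aeval w (F i))
    fun i ↦ (totalDegree_aeval_le totalDegree_w _).trans (hF i).totalDegree_le
  refine ⟨S, hS, fun s hs ↦ ?_⟩
  obtain ⟨x, hx⟩ := exists_eval_eq_zero_of_odd_finrank_quotient <| by
    rw [h s hs]
    exact Finset.prod_induction _ Odd (fun _ _ ↦ Odd.mul) odd_one fun i _ ↦ hd i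
  have v_ne_zero : (Fin.cons 1 x : Fin (n + 1) → ℝ) ≠ 0 := fun h ↦
    one_ne_zero (α := ℝ) (congrFun h 0)
  obtain ⟨u, hu, hu'⟩ := exists_sum_sq_eq_one_and_eval_eq_zero_of_ne_zero
    (F := fun i ↦ X i.succ ^ d i + C s * F i)
    (fun i ↦ (isHomogeneous_X_pow _ _).add ((hF i).C_mul s)) v_ne_zero
    fun i ↦ by
      simpa only [deform, eval_aeval_w, map_add, map_mul, map_pow, eval_X, eval_C, Fin.cons_succ]
        using hx i
  exact ⟨u, hu, fun i ↦ by simpa using hu' i⟩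

theorem isCompact_setOf_sum_sq_eq_one (σ : Type*) [Fintype σ] :
    IsCompact {u : σ → ℝ | ∑ j, u j ^ 2 = 1} := by
  refine (isCompact_univ_pi fun _ ↦ isCompact_Icc (a := (-1 : ℝ)) (b := 1)).of_isClosed_subset
    (isClosed_eq (by fun_prop) continuous_const) fun u hu j _ ↦ ?_
  rw [Set.mem_Icc, ← abs_le, ← sq_le_one_iff_abs_le_one, ← (hu : ∑ j, u j ^ 2 = 1)]
  exact Finset.single_le_sum (f := fun j ↦ u j ^ 2) (fun j _ ↦ sq_nonneg _) (Finset.mem_univ j)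

theorem exists_sum_sq_eq_one_and_eval_eq_zero (hd : ∀ i, Odd (d i))
    {F : Fin n → MvPolynomial (Fin (n + 1)) ℝ} (hF : ∀ i, (F i).IsHomogeneous (d i)) :
    ∃ u : Fin (n + 1) → ℝ, ∑ j, u j ^ 2 = 1 ∧ ∀ i, eval u (F i) = 0 := by
  let K := {u : Fin (n + 1) → ℝ | ∑ j, u j ^ 2 = 1}
  have := isCompact_iff_compactSpace.1 (isCompact_setOf_sum_sq_eq_one (Fin (n + 1)))
  let Z : Set (K × ℝ) := {p | ∀ i, p.2 * p.1.1 i.succ ^ d i + eval p.1.1 (F i) = 0}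
  have isClosed_image : IsClosed (Prod.snd '' Z) := by
    refine isClosedMap_snd_of_compactSpace _ ?_
    simp only [Z, Set.ofPred_forall]
    have continuous_val : Continuous fun p : K × ℝ ↦ p.1.1 :=
      continuous_subtype_val.comp continuous_fst
    refine isClosed_iInter fun i ↦ isClosed_eq ?_ continuous_const
    exact (continuous_snd.mul (((continuous_apply _).comp continuous_val).pow _)).add
      ((continuous_eval (F i)).comp continuous_val)
  obtain ⟨S, hS, h⟩ := exists_countable_exists_pow_add_mul_eval_eq_zero hd hF
  have compl_subset : (insert 0 (Inv.inv ⁻¹' S))ᶜ ⊆ Prod.snd '' Z := fun t ht ↦ by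
    obtain ⟨ht0, htS⟩ := not_or.1 ht
    obtain ⟨u, hu, hu'⟩ := h t⁻¹ htS
    refine ⟨(⟨u, hu⟩, t), fun i ↦ ?_, rfl⟩
    have := congrArg (t * ·) (hu' i)
    simpa [mul_add, mul_inv_cancel_left₀ ht0] using this
  have dense_compl := ((hS.preimage inv_injective).insert 0).dense_compl ℝ
  obtain ⟨⟨u, _⟩, hu, rfl : _ = 0⟩ :=
    isClosed_image.closure_subset_iff.2 compl_subset (dense_compl 0)
  exact ⟨u, u.2, fun i ↦ by simpa using hu i⟩

theorem exists_sum_sq_eq_one_and_eval_eq_zero_of_lt {m r : ℕ} (hm : m < r) {d : Fin m → ℕ}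
    (hd : ∀ i, Odd (d i)) {F : Fin m → MvPolynomial (Fin r) ℝ}
    (hF : ∀ i, (F i).IsHomogeneous (d i)) :
    ∃ u : Fin r → ℝ, ∑ j, u j ^ 2 = 1 ∧ ∀ i, eval u (F i) = 0 := by
  obtain ⟨n, rfl⟩ := Nat.exists_eq_add_of_le' (Nat.one_le_of_lt hm)
  let ι : Fin m → Fin n := Fin.castLE (Nat.le_of_lt_succ hm)
  have ι_injective : Function.Injective ι := Fin.castLE_injective _
  have odd_extend (j : Fin n) : Odd (Function.extend ι d 1 j) := by
    by_cases hj : ∃ i, ι i = j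
    · obtain ⟨i, rfl⟩ := hj
      simpa only [ι_injective.extend_apply] using hd i
    · simp [Function.extend_apply' _ _ _ hj]
  have isHomogeneous_extend (j : Fin n) :
      (Function.extend ι F 0 j).IsHomogeneous (Function.extend ι d 1 j) := by
    by_cases hj : ∃ i, ι i = j
    · obtain ⟨i, rfl⟩ := hj
      simpa only [ι_injective.extend_apply] using hF i
    · rw [Function.extend_apply' _ _ _ hj]
      exact isHomogeneous_zero _ _ _
  obtain ⟨u, hu, hu'⟩ := exists_sum_sq_eq_one_and_eval_eq_zero odd_extend isHomogeneous_extend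
  exact ⟨u, hu, fun i ↦ by simpa only [ι_injective.extend_apply] using hu' (ι i)⟩

end BorsukUlam

/-! ### The sphere is not generated by fewer elements -/

theorem eq_of_adjoin_eq_top {R A B : Type*} [CommSemiring R] [Semiring A] [Algebra R A]
    [Semiring B] {s : Set A} (hs : Algebra.adjoin R s = ⊤) {f g : A →+* B}
    (h_algebraMap : ∀ c, f (algebraMap R A c) = g (algebraMap R A c)) (h : s.EqOn f g) :
    f = g := by
  ext x
  induction hs.ge (Algebra.mem_top (x := x)) using Algebra.adjoin_induction with
  | mem x hx => exact h hx
  | algebraMap c => exact h_algebraMap c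
  | add x y _ _ hx hy => rw [map_add, map_add, hx, hy]
  | mul x y _ _ hx hy => rw [map_mul, map_mul, hx, hy]

namespace SphereRing

variable {r : ℕ}

theorem mk_eq_aeval (p : MvPolynomial (Fin r) ℝ) : mk r p = aeval z p := by
  refine DFunLike.congr_fun (MvPolynomial.algHom_ext (f := mk r) fun i ↦ ?_) p
  rw [aeval_X, z]

theorem isHomogeneous_sum_sq_pow (r l : ℕ) :
    ((∑ i : Fin r, X i ^ 2 : MvPolynomial (Fin r) ℝ) ^ l).IsHomogeneous (2 * l) :=
  .pow (.sum _ _ _ fun i _ ↦ by simpa using (isHomogeneous_X ℝ i).pow 2) l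

theorem mk_mul_sum_sq_pow (p : MvPolynomial (Fin r) ℝ) (l : ℕ) :
    mk r (p * (∑ i, X i ^ 2) ^ l) = mk r p := by
  have mk_sum_sq : mk r (∑ i, X i ^ 2) = 1 := by
    simp only [map_sum, map_pow]
    exact sum_z_sq r
  rw [map_mul, map_pow, mk_sum_sq, one_pow, mul_one]

theorem neg_mk_of_isHomogeneous {p : MvPolynomial (Fin r) ℝ} {m : ℕ} (hp : p.IsHomogeneous m) :
    neg r (mk r p) = (-1) ^ m * mk r p := by
  rw [mk_eq_aeval, ← aeval_mul_of_isHomogeneous hp, ← AlgEquiv.coe_toAlgHom, ← AlgHom.comp_apply,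
    comp_aeval]
  simp only [AlgEquiv.coe_toAlgHom, neg_z, neg_one_mul]

theorem two_mul_sum_filter_odd_homogeneousComponent (p : MvPolynomial (Fin r) ℝ) :
    2 * ∑ d ∈ Finset.range (p.totalDegree + 1) with Odd d, mk r (homogeneousComponent d p) =
      mk r p - neg r (mk r p) := by
  have mk_eq : mk r p =
      ∑ d ∈ Finset.range (p.totalDegree + 1), mk r (homogeneousComponent d p) := by
    rw [← map_sum, sum_homogeneousComponent]
  rw [mk_eq, map_sum, ← Finset.sum_sub_distrib, Finset.sum_filter, Finset.mul_sum]
  refine Finset.sum_congr rfl fun d _ ↦ ?_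
  rw [neg_mk_of_isHomogeneous (homogeneousComponent_isHomogeneous d p)]
  split_ifs with hd
  · rw [hd.neg_one_pow, neg_one_mul, sub_neg_eq_add, two_mul]
  · rw [(Nat.not_odd_iff_even.1 hd).neg_one_pow, one_mul, sub_self, mul_zero]

theorem exists_isHomogeneous_of_neg_eq_neg {x : SphereRing r} (hx : neg r x = -x) :
    ∃ d, Odd d ∧ ∃ G : MvPolynomial (Fin r) ℝ, G.IsHomogeneous d ∧ mk r G = x := by
  obtain ⟨p, rfl⟩ := mk_surjective r x
  set N := p.totalDegree with hN
  refine ⟨2 * N + 1, odd_two_mul_add_one N, ∑ d ∈ Finset.range (N + 1) with Odd d,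
    homogeneousComponent d p * (∑ i, X i ^ 2) ^ ((2 * N + 1 - d) / 2), ?_, ?_⟩
  · refine .sum _ _ _ fun d hd ↦ ?_
    obtain ⟨d_lt, k, d_eq⟩ := Finset.mem_filter.1 hd
    have degree_eq : 2 * N + 1 = d + 2 * ((2 * N + 1 - d) / 2) := by
      have := Finset.mem_range.1 d_lt
      omega
    rw (occs := .pos [2]) [degree_eq]
    exact (homogeneousComponent_isHomogeneous d p).mul (isHomogeneous_sum_sq_pow r _)
  · have two_mul_sum := two_mul_sum_filter_odd_homogeneousComponent p
    simp only [map_sum, mk_mul_sum_sq_pow]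
    rw [hx, ← hN] at two_mul_sum
    linear_combination algebraMap ℝ (SphereRing r) (1 / 2) * two_mul_sum + (mk r p -
      ∑ d ∈ Finset.range (N + 1) with Odd d, mk r (homogeneousComponent d p)) *
        two_mul_algebraMap_half (SphereRing r)

/-- Borsuk–Ulam for regular functions. -/
theorem exists_lift_eq_zero_of_neg_eq_neg {m : ℕ} (hm : m < r) {c : Fin m → SphereRing r}
    (hc : ∀ i, neg r (c i) = -c i) :
    ∃ (u : Fin r → ℝ) (hu : ∑ j, u j ^ 2 = 1), ∀ i, lift u hu (c i) = 0 := by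
  choose d hd G hG mk_G using fun i ↦ exists_isHomogeneous_of_neg_eq_neg (hc i)
  obtain ⟨u, hu, eval_G⟩ := exists_sum_sq_eq_one_and_eval_eq_zero_of_lt hm hd hG
  exact ⟨u, hu, fun i ↦ by rw [← mk_G, lift_mk, aeval_eq_eval, eval_G]⟩

theorem not_isGeneratedBy {m : ℕ} (hm : m < r) : ¬ IsGeneratedBy (Fixed r) (SphereRing r) m := by
  rintro ⟨a, ha⟩
  obtain ⟨u, hu, lift_sub_neg⟩ := exists_lift_eq_zero_of_neg_eq_neg hm
    (c := fun i ↦ a i - neg r (a i)) fun i ↦ by rw [map_sub, neg_neg, neg_sub]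
  have lift_neg : (lift u hu).toRingHom =
      (lift u hu).toRingHom.comp (neg r : SphereRing r →+* SphereRing r) := by
    refine eq_of_adjoin_eq_top ha (fun c ↦ congrArg (lift u hu) (neg_coe c).symm) ?_
    rintro _ ⟨i, rfl⟩
    exact sub_eq_zero.1 ((map_sub _ _ _).symm.trans (lift_sub_neg i))
  have u_eq_zero (i : Fin r) : u i = 0 := by
    have h : lift u hu (z i) = lift u hu (neg r (z i)) := DFunLike.congr_fun lift_neg (z i)
    rw [neg_z, map_neg, lift_z] at h
    exact self_eq_neg.1 h
  simp [u_eq_zero] at hu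

theorem isEtaleOfDegree_prod (r k : ℕ) :
    IsEtaleOfDegree (Fixed r) (SphereRing r × (Fin k → Fixed r)) (2 + k) := by
  simpa only [Fintype.card_fin] using (isEtaleOfDegree_two r).prod (isEtaleOfDegree_pi _ (Fin k))

theorem not_isGeneratedBy_prod {m : ℕ} (hm : m < r) (k : ℕ) :
    ¬ IsGeneratedBy (Fixed r) (SphereRing r × (Fin k → Fixed r)) m := fun h ↦
  not_isGeneratedBy hm (h.of_surjective (AlgHom.fst _ _ _) Prod.fst_surjective)

end SphereRing

theorem mainTheorem2 :
    (∀ r : ℕ, 1 ≤ r →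
      -- `R` is a smooth `ℝ`-algebra of dimension `r - 1`
      (Algebra.Smooth ℝ (SphereRing.Fixed r) ∧
        ringKrullDim (SphereRing.Fixed r) = ((r - 1 : ℕ) : WithBot ℕ∞)) ∧
      -- `S` is a quadratic étale `R`-algebra, generated by `r` elements but not by fewer
      (IsEtaleOfDegree (SphereRing.Fixed r) (SphereRing r) 2 ∧
        IsGeneratedBy (SphereRing.Fixed r) (SphereRing r) r ∧
        ∀ m < r, ¬ IsGeneratedBy (SphereRing.Fixed r) (SphereRing r) m) ∧
      -- the same for the algebra `S × R^(n-2)` of degree `n`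
      ∀ n : ℕ, 2 ≤ n →
        IsEtaleOfDegree (SphereRing.Fixed r)
          (SphereRing r × (Fin (n - 2) → SphereRing.Fixed r)) n ∧
        IsGeneratedBy (SphereRing.Fixed r)
          (SphereRing r × (Fin (n - 2) → SphereRing.Fixed r)) r ∧
        ∀ m < r, ¬ IsGeneratedBy (SphereRing.Fixed r)
          (SphereRing r × (Fin (n - 2) → SphereRing.Fixed r)) m) ∧
    -- in every dimension `d` and degree `n ≥ 2` no bound smaller than `d + 1` is valid
    (∀ d n m : ℕ, 2 ≤ n →
      (∀ (R : Type) [CommRing R] [Algebra ℝ R], Algebra.Smooth ℝ R →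
        ringKrullDim R = (d : WithBot ℕ∞) →
        ∀ (A : Type) [CommRing A] [Algebra R A], IsEtaleOfDegree R A n → IsGeneratedBy R A m) →
      d + 1 ≤ m) := by
  refine ⟨fun r hr ↦ ?_, fun d n m hn h ↦ ?_⟩
  · obtain ⟨d, rfl⟩ := Nat.exists_eq_add_of_le' hr
    refine ⟨⟨inferInstance, SphereRing.ringKrullDim_fixed_succ d⟩,
      ⟨SphereRing.isEtaleOfDegree_two _, ⟨_, SphereRing.adjoin_fixed_range_z _⟩,
        fun m ↦ SphereRing.not_isGeneratedBy⟩, fun n hn ↦ ?_⟩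
    obtain ⟨k, rfl⟩ := Nat.exists_eq_add_of_le hn
    rw [Nat.add_sub_cancel_left]
    exact ⟨SphereRing.isEtaleOfDegree_prod _ k, SphereRing.isGeneratedBy_prod d k,
      fun m hm ↦ SphereRing.not_isGeneratedBy_prod hm k⟩
  · obtain ⟨k, rfl⟩ := Nat.exists_eq_add_of_le hn
    by_contra! hm
    exact SphereRing.not_isGeneratedBy_prod hm k <| h _ inferInstance
      (SphereRing.ringKrullDim_fixed_succ d) _ (SphereRing.isEtaleOfDegree_prod _ k)
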